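/- Let $\Sigma\subset i\mathfrak t^*$ be the root system of a compact simply connected simple Lie group with Cartan subalgebra $\mathfrak t$ (an irreducible reduced crystallographic root system of rank $r=\dim\mathfrak t$, consisting of linear forms on $\mathfrak t$ with imaginary values). Let $\Sigma^+$ be a positive system with simple roots $\alpha_1,\dots,\alpha_r$, let $-\alpha_0$ be the highest root, and put $t_j(H)=\alpha_j(H)/2\pi i+\delta_{0j}$ for $0\le j\le r$, where $\delta_{0j}$ is the Kronecker delta. Let $A=\{H\in\mathfrak t: t_j(H)>0\ \text{for all } j\}$ be the open fundamental alcove, and for $J\subsetneq\{0,\dots,r\}$ let $A_J=\{H: t_j(H)=0\ \text{for } j\in J,\ t_j(H)>0\ \text{for } j\notin J\}$ be the facets of its closure. Let $\Sigma_J$ be the root subsystem with simple roots $\alpha_j$, $j\in J$, and let $\Sigma_J^+$ be its positive system, i.e. the set of roots of $\Sigma$ that are combinations of the $\alpha_j$, $j\in J$, with nonnegative integer coefficients. Let $I\subset\{0,\dots,r\}$ with $|I|=r$ and let $J\subset I$. Let $C_I$ be the convex hull of the barycenters (means of the vertices) of the facets $A_K$, $K\subset I$. For $N\ge1$ put $$P_{I,J}=\{H\in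 A\cap C_I:\ t_j(H)\le N^{-1}\ \text{for } j\in J,\ t_j(H)>N^{-1}\ \text{for } j\notin J\},$$ $$\delta_{I,J}(H)=\prod_{\alpha\in\Sigma_I^+\setminus\Sigma_J^+}\left(e^{\alpha(H)/2}-e^{-\alpha(H)/2}\right).$$ Fix a Haar (Lebesgue) measure on $\mathfrak t$ and let $0<p\le\infty$, with $r/p=0$ when $p=\infty$. Then, for all $N\ge1$, $$\left\|\frac1{\delta_{I,J}}\right\|_{L^p(P_{I,J})}\le\begin{cases} C\,N^{|\Sigma^+|-|\Sigma_J^+|-r/p}, & p>\frac r{|\Sigma^+|},\\ C_\varepsilon\,N^{-|\Sigma_J^+|+\varepsilon}\ \text{ for every } \varepsilon>0, & p=\frac r{|\Sigma^+|},\\ C\,N^{-|\Sigma_J^+|}, & p<\frac r{|\Sigma^+|},\end{cases}$$ where the constant $C$ does not depend on $N$ and $C_\varepsilon$ depends on $\varepsilon$ but not on $N$. -/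

import Mathlib

open scoped ENNReal

/-! The real vector space `𝔱` is the Cartan subalgebra and `M` is its dual, through the perfect
pairing of the root pairing `P`. The imaginary-valued roots `α ∈ i𝔱*` are `α = i a`, where `a` runs
over the roots `P.root k`. The set of nodes `{0, 1, …, r}` of the extended Dynkin diagram is
`Option b.support`: the node `0` is `none`, the other nodes are the simple roots. -/

namespace WeylAlcove

variable {ι M 𝔱 : Type*} [AddCommGroup M] [Module ℝ M] [AddCommGroup 𝔱] [Module ℝ 𝔱]
  {P : RootPairing ι ℝ M 𝔱}

/-- `θ` is the highest root with respect to the base `b`: for every root `β`, the difference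
`θ - β` is a sum of simple roots. -/
def IsHighestRoot (b : P.Base) (θ : ι) : Prop :=
  ∀ k : ι, P.root θ - P.root k ∈ AddSubmonoid.closure (P.root '' (b.support : Set ι))

/-- The roots `α₀, α₁, …, α_r`: the lowest root `α₀ = -θ` and the simple roots. -/
def extRoot (b : P.Base) (θ : ι) : Option b.support → M
  | none => -P.root θ
  | some j => P.root j

/-- The value `α(H) = i a(H)` of the imaginary-valued root `α = i a`. -/
noncomputable def rootValue (P : RootPairing ι ℝ M 𝔱) (k : ι) (H : 𝔱) : ℂ :=
  Complex.I * (P.toLinearMap (P.root k) H : ℂ)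

/-- The affine coordinates `t_j(H) = α_j(H) / (2πi) + δ_{0j}`. -/
noncomputable def wallCoord (b : P.Base) (θ : ι) (j : Option b.support) (H : 𝔱) : ℝ :=
  P.toLinearMap (extRoot b θ j) H / (2 * Real.pi) + (if j = none then 1 else 0)

/-- The open fundamental alcove `A`. -/
def alcove (b : P.Base) (θ : ι) : Set 𝔱 :=
  {H | ∀ j, 0 < wallCoord b θ j H}

/-- The facet `A_J` of the closed alcove. -/
def facet (b : P.Base) (θ : ι) (J : Finset (Option b.support)) : Set 𝔱 :=
  {H | (∀ j ∈ J, wallCoord b θ j H = 0) ∧ ∀ j ∉ J, 0 < wallCoord b θ j H}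

open Classical in
/-- `x` is the barycenter of the facet `A_J` (`J` proper): the mean of the vertices of `A_J`. Here
`v k` is the vertex of the alcove opposite to the wall `t_k = 0`, that is, the unique point of the
facet of all nodes but `k`; it is a vertex of `A_J` exactly when `k ∉ J`. -/
def IsFacetBarycenter (b : P.Base) (θ : ι) (J : Finset (Option b.support)) (x : 𝔱) : Prop :=
  ∃ v : Option b.support → 𝔱,
    (∀ k, v k ∈ facet b θ (Finset.univ.erase k)) ∧ x = Finset.centroid ℝ Jᶜ v

/-- The barycentric piece `C_I`: the convex hull of the barycenters of the facets `A_J`, `J ⊆ I`. -/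
def baryPiece (b : P.Base) (θ : ι) (I : Finset (Option b.support)) : Set 𝔱 :=
  convexHull ℝ {x | ∃ J ⊆ I, IsFacetBarycenter b θ J x}

/-- The semiclassical piece `P_J` at scale `N⁻¹`. -/
def semiPiece (b : P.Base) (θ : ι) (N : ℝ) (J : Finset (Option b.support)) : Set 𝔱 :=
  {H | H ∈ alcove b θ ∧ (∀ j ∈ J, wallCoord b θ j H ≤ N⁻¹) ∧ ∀ j ∉ J, N⁻¹ < wallCoord b θ j H}

/-- The barycentric-semiclassical piece `P_{I,J} = P_J ∩ C_I`. -/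
def piece (b : P.Base) (θ : ι) (N : ℝ) (I J : Finset (Option b.support)) : Set 𝔱 :=
  semiPiece b θ N J ∩ baryPiece b θ I

open Classical in
/-- The positive system `Σ⁺` of the base `b`. -/
noncomputable def posRoots [Fintype ι] (b : P.Base) : Finset ι :=
  {k | P.root k ∈ AddSubmonoid.closure (P.root '' (b.support : Set ι))}

open Classical in
/-- The positive system `Σ_J⁺` (with simple roots `α_j`, `j ∈ J`) of the root subsystem `Σ_J`: the
roots that are sums of roots `α_j`, `j ∈ J`. -/
noncomputable def subPosRoots [Fintype ι] (b : P.Base) (θ : ι) (J : Finset (Option b.support)) :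
    Finset ι :=
  {k | P.root k ∈ AddSubmonoid.closure (extRoot b θ '' (J : Set (Option b.support)))}

open Classical in
/-- The weight function `δ_{I,J}`. -/
noncomputable def weight [Fintype ι] (b : P.Base) (θ : ι) (I J : Finset (Option b.support))
    (H : 𝔱) : ℂ :=
  ∏ k ∈ subPosRoots b θ I \ subPosRoots b θ J,
    (Complex.exp (rootValue P k H / 2) - Complex.exp (-(rootValue P k H / 2)))

/-- The `L^p` (quasi)norm of `1 / δ_{I,J}` on `P_{I,J}`, at scale `N⁻¹`. -/
noncomputable def invWeightNorm [Fintype ι] [MeasurableSpace 𝔱] (b : P.Base) (θ : ι)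
    (μ : MeasureTheory.Measure 𝔱) (p : ℝ≥0∞) (N : ℝ) (I J : Finset (Option b.support)) : ℝ≥0∞ :=
  MeasureTheory.eLpNorm (fun H => 1 / weight b θ I J H) p (μ.restrict (piece b θ N I J))

end WeylAlcove

/-! ### Density of roots in a subspace. -/

namespace RootPairing

variable {ι N : Type*} [Fintype ι] [AddCommGroup N] [Module ℝ N]

/-! Write `ρ = |Σ⁺| / r`, and let `i` be the one node outside `I`. The estimate rests on a pointwise
bound by a product in the wall coordinates: on the piece, `1 / |δ_{I,J}|` is at most a constant
times `N ^ (ρ |J| - |Σ_J⁺|) ∏_{j ∈ I \ J} t_j ^ (-ρ)`. This gives the three regimes by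
one-dimensional integrals, since the `r` coordinates `t_j`, `j ∈ I`, are affine coordinates on `𝔱`.

For the pointwise bound, a root `α = ∑ n_j α_j` of `Σ_I⁺` contributes the factor `2 |sin (π s_α)|`
with `s_α = ∑ n_j t_j`. The marks `m_j` satisfy `∑ m_j t_j = 1` and `n_j ≤ m_j`, so `s_α ≤ 1 - m_i
t_i`; on `C_I` the term `m_i t_i` is bounded below. Hence the sine is comparable from below to
`s_α`, which is at least `t_j` for each `j` in the support of `α`.

How to distribute the roots among the coordinates is decided by a density inequality: every `K ⊆ I`
satisfies `|Σ_K⁺| ≤ ρ |K|` (`card_subPosRoots_mul_le`). A layer-cake argument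
(`sum_le_mul_sum_of_card_filter_subset_le`), applied to logarithms, turns this into the equal
exponent `ρ` on every coordinate. The density inequality itself is a trace computation: `∑ α^∨ ⊗ α`
commutes with the Weyl group, so it is scalar by irreducibility, and pairing it with the orthogonal
projection onto a subspace counts the roots there. -/

lemma rootForm_root_eq {M : Type*} [AddCommGroup M] [Module ℝ M] (P : RootPairing ι ℝ M N)
    (i : ι) (y : M) :
    2 * P.RootForm (P.root i) y = P.RootForm (P.root i) (P.root i) * P.coroot' i y := by
  have h := congrArg (fun z => P.toLinearMap y z) (P.rootForm_self_smul_coroot i)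
  simp only [map_smul, map_nsmul, toLinearMap_apply_apply_Polarization, smul_eq_mul,
    nsmul_eq_mul] at h
  simpa using h.symm

/-- The sum of the operators `1 - s_α` over all roots `α`. -/
noncomputable def sumOneSubReflection {M : Type*} [AddCommGroup M] [Module ℝ M]
    (P : RootPairing ι ℝ M N) : M →ₗ[ℝ] M :=
  ∑ i, (P.coroot' i).smulRight (P.root i)

lemma sumOneSubReflection_apply {M : Type*} [AddCommGroup M] [Module ℝ M]
    (P : RootPairing ι ℝ M N) (x : M) :
    P.sumOneSubReflection x = ∑ i, P.coroot' i x • P.root i := by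
  simp [sumOneSubReflection]

/-- A reflection permutes the roots and carries their coroots along, so it only reindexes the sum.
-/
lemma sumOneSubReflection_reflection {M : Type*} [AddCommGroup M] [Module ℝ M]
    (P : RootPairing ι ℝ M N) (j : ι) (x : M) :
    P.sumOneSubReflection (P.reflection j x) = P.reflection j (P.sumOneSubReflection x) := by
  rw [sumOneSubReflection_apply, sumOneSubReflection_apply, map_sum]
  rw [← Equiv.sum_comp (P.reflectionPerm j)]
  refine Finset.sum_congr rfl fun i _ => ?_
  rw [map_smul, P.root_reflectionPerm]
  congr 1
  simp [coroot', P.coroot_reflectionPerm, reflection_apply, coreflection_apply]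
  ring

section Inner

variable {E : Type*} [NormedAddCommGroup E] [InnerProductSpace ℝ E] [FiniteDimensional ℝ E]

/-- Since `T` is a scalar `c`, pairing with the identity gives `2 |Σ| = c dim E`. Pairing with the
orthogonal projection onto `V` gives `c dim V`, to which each root in `V` contributes `2` and each
other root a nonnegative amount. -/
lemma card_root_mem_mul_finrank_le_of_inner (P : RootPairing ι ℝ E N) [P.IsIrreducible]
    (hB : ∀ x y, P.RootForm x y = inner ℝ x y) (V : Submodule ℝ E) [DecidablePred (P.root · ∈ V)] :
    (Finset.univ.filter (P.root · ∈ V)).card * Module.finrank ℝ E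
      ≤ Module.finrank ℝ V * Fintype.card ι := by
  have := IsIrreducible.nontrivial P
  set T := P.sumOneSubReflection with hT
  have hroot (i : ι) (y : E) : 2 * inner ℝ (P.root i) y
      = inner ℝ (P.root i) (P.root i) * P.coroot' i y := by
    simpa only [hB] using P.rootForm_root_eq i y
  have hpos (i : ι) : 0 < inner ℝ (P.root i) (P.root i) :=
    real_inner_self_pos.2 (P.ne_zero i)
  have hco (i : ι) (y : E) : P.coroot' i y
      = 2 / inner ℝ (P.root i) (P.root i) * inner ℝ (P.root i) y := by
    have := hroot i y
    have := hpos i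
    field_simp
    linarith
  have hsymm : T.IsSymmetric := by
    intro x y
    simp only [hT, sumOneSubReflection_apply, sum_inner, inner_sum, inner_smul_left,
      inner_smul_right]
    refine Finset.sum_congr rfl fun i _ => ?_
    rw [hco, hco, real_inner_comm x]
    simp
    ring
  -- Symmetry supplies a real eigenvalue; its eigenspace is nonzero and invariant under all
  -- reflections, hence everything.
  obtain ⟨c, hc⟩ : ∃ c : ℝ, Module.End.HasEigenvalue T c :=
    ⟨_, hsymm.hasEigenvalue_iSup_of_finiteDimensional⟩
  have htop : Module.End.eigenspace T c = ⊤ := by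
    refine IsIrreducible.eq_top_of_invtSubmodule_reflection (P := P) _ (fun j => ?_) hc
    rw [Module.End.mem_invtSubmodule]
    intro x hx
    simp only [Submodule.mem_comap, Module.End.mem_eigenspace_iff] at hx ⊢
    rw [hT]
    erw [sumOneSubReflection_reflection]
    rw [← hT, hx]
    simp
  have hTc (x : E) : T x = c • x := by
    have : x ∈ Module.End.eigenspace T c := htop ▸ Submodule.mem_top
    exact Module.End.mem_eigenspace_iff.1 this
  have key (f : E →ₗ[ℝ] E) : ∑ i, P.coroot' i (f (P.root i)) = c * LinearMap.trace ℝ E f := by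
    have h1 : f ∘ₗ T = c • f := by
      ext x; simp [hTc]
    have h2 : f ∘ₗ T = ∑ i, (P.coroot' i).smulRight (f (P.root i)) := by
      ext x; simp [hT, sumOneSubReflection_apply]
    have h3 := congrArg (LinearMap.trace ℝ E) (h2.symm.trans h1)
    simpa [LinearMap.trace_smulRight] using h3
  have k1 : 2 * (Fintype.card ι : ℝ) = c * Module.finrank ℝ E := by
    have := key LinearMap.id
    simpa [LinearMap.trace_id, mul_comm] using this
  have k2 := key V.starProjection.toLinearMap
  have htr : LinearMap.trace ℝ E V.starProjection.toLinearMap = Module.finrank ℝ V := by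
    refine LinearMap.IsProj.trace (p := V) ⟨fun x => by simp, fun x hx => ?_⟩
    simpa using Submodule.starProjection_eq_self_iff.2 hx
  rw [htr] at k2
  have k3 : 2 * ((Finset.univ.filter (P.root · ∈ V)).card : ℝ) ≤
      ∑ i, P.coroot' i (V.starProjection.toLinearMap (P.root i)) := by
    calc 2 * ((Finset.univ.filter (P.root · ∈ V)).card : ℝ)
        = ∑ i ∈ Finset.univ.filter (P.root · ∈ V), (2 : ℝ) := by simp [mul_comm]
      _ = ∑ i ∈ Finset.univ.filter (P.root · ∈ V),
            P.coroot' i (V.starProjection.toLinearMap (P.root i)) := by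
          refine Finset.sum_congr rfl fun i hi => ?_
          have : V.starProjection (P.root i) = P.root i :=
            Submodule.starProjection_eq_self_iff.2 (Finset.mem_filter.1 hi).2
          simp [this]
      _ ≤ _ := by
          refine Finset.sum_le_sum_of_subset_of_nonneg (Finset.filter_subset _ _) fun i _ _ => ?_
          rw [hco]
          refine mul_nonneg (div_nonneg zero_le_two (hpos i).le) ?_
          -- The projection is idempotent and self-adjoint, so this is the squared length of the
          -- projected root.
          have : inner ℝ (P.root i) (V.starProjection (P.root i))
              = inner ℝ (V.starProjection (P.root i)) (V.starProjection (P.root i)) := by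
            have hV : V.starProjection (V.starProjection (P.root i)) = V.starProjection (P.root i) :=
              Submodule.starProjection_eq_self_iff.2 (Submodule.starProjection_apply_mem _ _)
            conv_lhs => rw [← hV]
            rw [← Submodule.inner_starProjection_left_eq_right]
          rw [ContinuousLinearMap.coe_coe, this]
          exact real_inner_self_nonneg
  have k4 : ((Finset.univ.filter (P.root · ∈ V)).card * Module.finrank ℝ E : ℝ)
      ≤ Module.finrank ℝ V * Fintype.card ι := by
    have hr : (0 : ℝ) ≤ Module.finrank ℝ E := Nat.cast_nonneg _
    have := mul_le_mul_of_nonneg_right (k3.trans_eq k2) hr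
    linear_combination this / 2 - (Module.finrank ℝ V : ℝ) / 2 * k1
  exact_mod_cast k4

end Inner

lemma card_root_mem_mul_finrank_le {M : Type*} [AddCommGroup M] [Module ℝ M]
    (P : RootPairing ι ℝ M N) [P.IsRootSystem] [P.IsIrreducible] (V : Submodule ℝ M)
    [DecidablePred (P.root · ∈ V)] :
    (Finset.univ.filter (P.root · ∈ V)).card * Module.finrank ℝ M
      ≤ Module.finrank ℝ V * Fintype.card ι := by
  have hspan : P.rootSpan ℝ = ⊤ := IsRootSystem.span_root_eq_top
  have : Module.Finite ℝ M := ⟨hspan ▸ Submodule.fg_span (Set.finite_range _)⟩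
  let core : InnerProductSpace.Core ℝ M :=
    { inner := fun x y => P.RootForm x y
      conj_inner_symm := fun x y => by simpa using P.rootForm_symmetric.eq y x
      re_inner_nonneg := fun x => by simpa using P.zero_le_rootForm x
      add_left := fun x y z => by simp
      smul_left := fun x y r => by simp
      definite := fun x hx => by
        refine P.eq_zero_of_mem_rootSpan_of_rootForm_self_eq_zero ?_ hx
        rw [hspan]; trivial }
  let := core.toNormedAddCommGroup
  let := InnerProductSpace.ofCore core.toCore
  exact P.card_root_mem_mul_finrank_le_of_inner (fun _ _ => rfl) V

end RootPairing

/-! ### Marks and coefficients of roots over the extended simple roots. -/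

namespace WeylAlcove

variable {ι M 𝔱 : Type*} [AddCommGroup M] [Module ℝ M] [AddCommGroup 𝔱] [Module ℝ 𝔱]
  {P : RootPairing ι ℝ M 𝔱}

/-- The marks of the extended Dynkin diagram: `1` at the affine node, and the coefficients of the
root `θ` at the other nodes. -/
noncomputable def mark [P.IsRootSystem] (b : P.Base) (θ : ι) : Option b.support → ℝ
  | none => 1
  | some j => b.toWeightBasis.repr (P.root θ) j

lemma repr_nonneg_of_mem_closure [P.IsRootSystem] (b : P.Base) {x : M}
    (hx : x ∈ AddSubmonoid.closure (P.root '' (b.support : Set ι))) (j : b.support) :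
    0 ≤ b.toWeightBasis.repr x j := by
  classical
  induction hx using AddSubmonoid.closure_induction with
  | mem x hx =>
    obtain ⟨i, hi, rfl⟩ := hx
    rw [b.toWeightBasis_repr_root ⟨i, hi⟩, Finsupp.single_apply]
    split_ifs <;> norm_num
  | zero => simp
  | add x y _ _ hx hy => simpa using add_nonneg hx hy

section

variable [P.IsRootSystem] {b : P.Base} {θ : ι} (hθ : IsHighestRoot b θ)
include hθ

lemma repr_root_le_mark (k : ι) (j : b.support) :
    b.toWeightBasis.repr (P.root k) j ≤ mark b θ (some j) := by
  have := repr_nonneg_of_mem_closure b (hθ k) j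
  simpa [mark] using this

lemma neg_mark_le_repr_root (k : ι) (j : b.support) :
    -mark b θ (some j) ≤ b.toWeightBasis.repr (P.root k) j := by
  have := repr_root_le_mark hθ (P.reflectionPerm k k) j
  simp only [RootPairing.root_reflectionPerm, RootPairing.reflection_apply_self, map_neg,
    Finsupp.coe_neg, Pi.neg_apply] at this
  linarith

lemma one_le_mark (j : Option b.support) : 1 ≤ mark b θ j := by
  cases j with
  | none => exact le_rfl
  | some j => simpa using repr_root_le_mark hθ j j

end

section

variable [P.IsRootSystem] (b : P.Base) (θ : ι)

lemma repr_sum_extRoot (c : Option b.support → ℝ) (j : b.support) :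
    b.toWeightBasis.repr (∑ i, c i • extRoot b θ i) j
      = c (some j) - c none * mark b θ (some j) := by
  classical
  simp only [Fintype.sum_option, extRoot, map_add, map_sum, map_smul, map_neg,
    Finsupp.coe_add, Pi.add_apply, Finsupp.coe_smul, Pi.smul_apply, Finsupp.coe_neg, Pi.neg_apply,
    smul_eq_mul, Finsupp.finsetSum_apply, b.toWeightBasis_repr_root, mark]
  simp [Finsupp.single_apply]
  ring

lemma sum_mark_smul_extRoot : ∑ i, mark b θ i • extRoot b θ i = 0 := by
  apply b.toWeightBasis.repr.injective
  ext j
  rw [repr_sum_extRoot]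
  simp [mark]

variable {b θ}

/-- The roots `α_j` with `j ≠ i` are linearly independent. -/
lemma eq_zero_of_sum_extRoot_eq_zero (hθ : IsHighestRoot b θ) {c : Option b.support → ℝ}
    (hc : ∑ i, c i • extRoot b θ i = 0) {i : Option b.support} (hi : c i = 0) : c = 0 := by
  have h (j : b.support) : c (some j) = c none * mark b θ (some j) := by
    have := repr_sum_extRoot b θ c j
    rw [hc] at this
    simp at this
    linarith
  have hn : c none = 0 := by
    cases i with
    | none => exact hi
    | some j =>
      have h1 := one_le_mark hθ (some j)
      have h2 := h j
      rw [hi] at h2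
      rcases mul_eq_zero.1 h2.symm with h3 | h3
      · exact h3
      · linarith
  ext j
  cases j with
  | none => exact hn
  | some j => simp [h j, hn]

/-- All linear relations among the extended roots are multiples of the mark relation, whose
coefficients are nonzero, so agreement at one node forces agreement everywhere. This makes the
support of a root of `Σ_I⁺` well defined. -/
lemma eq_of_sum_extRoot_eq (hθ : IsHighestRoot b θ) {n n' : Option b.support → ℕ}
    (h : ∑ i, n i • extRoot b θ i = ∑ i, n' i • extRoot b θ i) {i : Option b.support}
    (hi : n i = n' i) : n = n' := by
  have := eq_zero_of_sum_extRoot_eq_zero hθ (c := fun j => (n j : ℝ) - n' j) (i := i)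
    (by simp only [sub_smul, Finset.sum_sub_distrib, Nat.cast_smul_eq_nsmul, h, sub_self])
    (by simp [hi])
  ext j
  have := congrFun this j
  simp only [Pi.zero_apply, sub_eq_zero] at this
  exact_mod_cast this

omit [P.IsRootSystem] in
lemma mem_closure_extRoot_iff {K : Finset (Option b.support)} {x : M} :
    x ∈ AddSubmonoid.closure (extRoot b θ '' (K : Set (Option b.support))) ↔
      ∃ n : Option b.support → ℕ, (∀ j ∉ K, n j = 0) ∧ x = ∑ i, n i • extRoot b θ i := by
  classical
  constructor
  · intro hx
    induction hx using AddSubmonoid.closure_induction with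
    | mem x hx =>
      obtain ⟨i, hi, rfl⟩ := hx
      refine ⟨Pi.single i 1, fun j hj => ?_, ?_⟩
      · rw [Pi.single_apply, if_neg]
        rintro rfl
        exact hj hi
      · rw [Finset.sum_eq_single i] <;> simp +contextual
    | zero => exact ⟨0, by simp⟩
    | add x y _ _ hx hy =>
      obtain ⟨n, hn, rfl⟩ := hx
      obtain ⟨n', hn', rfl⟩ := hy
      exact ⟨n + n', fun j hj => by simp [hn j hj, hn' j hj], by
        simp [add_smul, Finset.sum_add_distrib]⟩
  · rintro ⟨n, hn, rfl⟩
    refine sum_mem fun i _ => ?_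
    by_cases hi : i ∈ K
    · exact nsmul_mem (AddSubmonoid.subset_closure (Set.mem_image_of_mem _ hi)) _
    · simp [hn i hi]

/-- The coefficients of a root of `Σ_K⁺` are bounded by the marks. -/
lemma coeff_le_mark (hθ : IsHighestRoot b θ) {k : ι} {n : Option b.support → ℕ}
    (hn : P.root k = ∑ i, n i • extRoot b θ i) {i : Option b.support} (hi : n i = 0)
    (j : Option b.support) : (n j : ℝ) ≤ mark b θ j := by
  have hr (j : b.support) : b.toWeightBasis.repr (P.root k) j
      = n (some j) - n none * mark b θ (some j) := by
    rw [← repr_sum_extRoot b θ (fun j => (n j : ℝ)) j, hn]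
    simp only [Nat.cast_smul_eq_nsmul]
  rcases Nat.eq_zero_or_pos (n none) with h0 | h0
  · cases j with
    | none => simp [h0, mark]
    | some j => simpa [hr, h0] using repr_root_le_mark hθ k j
  · cases i with
    | none => omega
    | some i =>
      have h1 := neg_mark_le_repr_root hθ k i
      have hm := one_le_mark hθ (some i)
      rw [hr, hi, Nat.cast_zero, zero_sub, neg_le_neg_iff] at h1
      -- The simple coordinate at `i` is `-n₀ m_i`, and no root goes below `-m_i`.
      have h2 : n none = 1 := by
        have : (n none : ℝ) ≤ 1 := by
          by_contra! hlt
          nlinarith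
        have : n none ≤ 1 := by exact_mod_cast this
        omega
      cases j with
      | none => simp [h2, mark]
      | some j =>
        -- The coordinate at `i` is `-m_i < 0`, so the root is negative; its coordinates `n_j - m_j`
        -- are then all nonpositive.
        rcases b.root_mem_or_neg_mem k with hk | hk
        · have := repr_nonneg_of_mem_closure b hk i
          rw [hr, hi, h2] at this
          norm_num at this
          linarith
        · have := repr_nonneg_of_mem_closure b hk j
          rw [map_neg, Finsupp.neg_apply, hr, h2] at this
          norm_num at this
          exact this

variable (b) in
lemma finrank_eq_card_support : Module.finrank ℝ M = b.support.card := by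
  rw [Module.finrank_eq_card_basis b.toWeightBasis]; simp

end

/-! ### Counting positive roots of subsystems. -/

section

variable [Fintype ι] [P.IsRootSystem] {b : P.Base} {θ : ι}

omit [P.IsRootSystem] in
lemma mem_subPosRoots {K : Finset (Option b.support)} {k : ι} :
    k ∈ subPosRoots b θ K ↔
      ∃ n : Option b.support → ℕ, (∀ j ∉ K, n j = 0) ∧ P.root k = ∑ i, n i • extRoot b θ i := by
  simp [subPosRoots, mem_closure_extRoot_iff]

omit [P.IsRootSystem] in
lemma card_le_two_mul_card_posRoots (b : P.Base) :
    Fintype.card ι ≤ 2 * (posRoots b).card := by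
  classical
  have : (Finset.univ : Finset ι) ⊆
      posRoots b ∪ (posRoots b).image (fun k => P.reflectionPerm k k) := by
    intro k _
    rw [Finset.mem_union, Finset.mem_image]
    rcases b.root_mem_or_neg_mem k with hk | hk
    · left; simpa [posRoots] using hk
    · right
      refine ⟨P.reflectionPerm k k, by simpa [posRoots] using hk, ?_⟩
      apply P.root.injective
      rw [P.root_reflectionPerm, P.reflection_apply_self, P.root_reflectionPerm,
        P.reflection_apply_self, neg_neg]
  calc Fintype.card ι = (Finset.univ : Finset ι).card := rfl
    _ ≤ _ := Finset.card_le_card this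
    _ ≤ _ := Finset.card_union_le _ _
    _ ≤ (posRoots b).card + (posRoots b).card := Nat.add_le_add_left Finset.card_image_le _
    _ = _ := by ring

/-- `Σ_K⁺` and its negative both lie in the span. They are disjoint because `K` omits a node: a root
in both would give a vanishing sum with nonnegative coefficients, hence zero coefficients. -/
lemma two_mul_card_subPosRoots_le (hθ : IsHighestRoot b θ) {K : Finset (Option b.support)}
    {i : Option b.support} (hi : i ∉ K)
    [DecidablePred (P.root · ∈ Submodule.span ℝ (extRoot b θ '' (K : Set (Option b.support))))] :
    2 * (subPosRoots b θ K).card ≤ (Finset.univ.filter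
      (P.root · ∈ Submodule.span ℝ (extRoot b θ '' (K : Set (Option b.support))))).card := by
  classical
  set V := Submodule.span ℝ (extRoot b θ '' (K : Set (Option b.support)))
  have hmem {k : ι} (hk : k ∈ subPosRoots b θ K) : P.root k ∈ V := by
    obtain ⟨n, hn, h⟩ := mem_subPosRoots.1 hk
    rw [h]
    refine sum_mem fun j _ => ?_
    by_cases hj : j ∈ K
    · exact nsmul_mem (Submodule.subset_span (Set.mem_image_of_mem _ hj)) _
    · simp [hn j hj]
  have hinj : Function.Injective (fun k => P.reflectionPerm k k) := by
    intro k l h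
    have := congrArg P.root h
    simp only [RootPairing.root_reflectionPerm, RootPairing.reflection_apply_self, neg_inj] at this
    exact P.root.injective this
  have hdisj : Disjoint (subPosRoots b θ K)
      ((subPosRoots b θ K).image (fun k => P.reflectionPerm k k)) := by
    rw [Finset.disjoint_left]
    rintro _ h1 h2
    obtain ⟨k, hk, rfl⟩ := Finset.mem_image.1 h2
    obtain ⟨n, hn, h⟩ := mem_subPosRoots.1 hk
    obtain ⟨n', hn', h'⟩ := mem_subPosRoots.1 h1
    have h0 : n + n' = 0 := by
      refine eq_of_sum_extRoot_eq hθ ?_ (i := i) (by simp [hn i hi, hn' i hi])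
      simp only [Pi.add_apply, add_smul, Finset.sum_add_distrib, ← h, ← h']
      simp
    have : n = 0 := by
      ext j; have := congrFun h0 j; simp at this; simp [this.1]
    exact P.ne_zero k (by simp [h, this])
  calc 2 * (subPosRoots b θ K).card
      = (subPosRoots b θ K ∪ (subPosRoots b θ K).image (fun k => P.reflectionPerm k k)).card := by
        rw [Finset.card_union_of_disjoint hdisj, Finset.card_image_of_injective _ hinj]; ring
    _ ≤ _ := by
        refine Finset.card_le_card fun k hk => ?_
        simp only [Finset.mem_filter, Finset.mem_univ, true_and]
        rcases Finset.mem_union.1 hk with hk | hk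
        · exact hmem hk
        · obtain ⟨l, hl, rfl⟩ := Finset.mem_image.1 hk
          simpa using hmem hl

/-- The density of positive roots is maximal for the whole irreducible root system. -/
lemma card_subPosRoots_mul_le [P.IsIrreducible] (hθ : IsHighestRoot b θ)
    {K : Finset (Option b.support)} {i : Option b.support} (hi : i ∉ K) :
    (subPosRoots b θ K).card * b.support.card ≤ K.card * (posRoots b).card := by
  classical
  set V := Submodule.span ℝ (extRoot b θ '' (K : Set (Option b.support)))
  have h1 := two_mul_card_subPosRoots_le hθ hi
  have h2 := P.card_root_mem_mul_finrank_le V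
  rw [finrank_eq_card_support b] at h2
  have h3 : Module.finrank ℝ V ≤ K.card := by
    have := finrank_span_finset_le_card (R := ℝ) (K.image (extRoot b θ))
    rw [Finset.coe_image] at this
    exact this.trans Finset.card_image_le
  have h4 := card_le_two_mul_card_posRoots b
  have := calc 2 * (subPosRoots b θ K).card * b.support.card
      ≤ _ := Nat.mul_le_mul_right _ h1
    _ ≤ _ := h2
    _ ≤ K.card * (2 * (posRoots b).card) := Nat.mul_le_mul h3 h4
  nlinarith

omit [P.IsRootSystem] in
lemma card_posRoots_pos [Nonempty ι] (b : P.Base) : 0 < (posRoots b).card := by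
  have h4 := card_le_two_mul_card_posRoots b
  have : 0 < Fintype.card ι := Fintype.card_pos
  omega

end

end WeylAlcove

/-! ### The layer-cake inequality and the bound for the sine. -/

namespace WeylAlcove

/-- Induction on the number of positive `L j`. Lowering these by their minimum `m` costs `ρ m |K|`
on the right and at most `m` times the number of `a` with `S a ⊆ K` on the left, where `K` is the
set of positive `L j`; the density hypothesis compares the two. -/
lemma sum_le_mul_sum_of_card_filter_subset_le {α β : Type*} [DecidableEq β]
    (A : Finset α) (B : Finset β) (S : α → Finset β) (hSB : ∀ a ∈ A, S a ⊆ B) (ρ : ℝ)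
    (hρ : ∀ K ⊆ B, ((A.filter (S · ⊆ K)).card : ℝ) ≤ ρ * K.card)
    (L : β → ℝ) (hL : ∀ j ∈ B, 0 ≤ L j) (f : α → ℝ) (hf : ∀ a ∈ A, ∀ j ∈ S a, f a ≤ L j) :
    ∑ a ∈ A, f a ≤ ρ * ∑ j ∈ B, L j := by
  induction h : (B.filter (0 < L ·)).card using Nat.strong_induction_on generalizing L f with
  | _ n ih =>
    set K := B.filter (0 < L ·) with hK
    have hKB : K ⊆ B := Finset.filter_subset _ _
    have hL0 : ∀ j ∈ B, j ∉ K → L j = 0 := fun j hj hjK =>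
      le_antisymm (not_lt.1 fun h => hjK (Finset.mem_filter.2 ⟨hj, h⟩)) (hL j hj)
    have hf0 : ∀ a ∈ A, ¬ S a ⊆ K → f a ≤ 0 := by
      intro a ha hS
      obtain ⟨j, hj, hjK⟩ := Finset.not_subset.1 hS
      exact (hf a ha j hj).trans_eq (hL0 j (hSB a ha hj) hjK)
    rcases K.eq_empty_or_nonempty with hKe | hKn
    -- The density hypothesis at the empty set excludes elements with empty `S a`, whose `f a` would
    -- be unconstrained.
    · have hemp : A.filter (S · ⊆ K) = ∅ := by
        have := hρ K hKB
        rw [hKe] at this ⊢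
        rw [← Finset.card_eq_zero]
        simp only [Finset.card_empty, Nat.cast_zero, mul_zero] at this
        exact_mod_cast le_antisymm this (Nat.cast_nonneg _)
      have h1 : ∑ a ∈ A, f a ≤ 0 := Finset.sum_nonpos fun a ha => hf0 a ha fun hS => by
        have : a ∈ A.filter (S · ⊆ K) := Finset.mem_filter.2 ⟨ha, hS⟩
        simp [hemp] at this
      have h2 : ∑ j ∈ B, L j = 0 := Finset.sum_eq_zero fun j hj => hL0 j hj (by simp [hKe])
      simpa [h2] using h1
    · obtain ⟨j₀, hj₀, hmin⟩ := K.exists_min_image L hKn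
      set m := L j₀
      have hm : 0 < m := (Finset.mem_filter.1 hj₀).2
      set L' : β → ℝ := fun j => if j ∈ K then L j - m else 0 with hL'
      set f' : α → ℝ := fun a => if S a ⊆ K then f a - m else 0 with hf'
      have hL'0 (j : β) : 0 ≤ L' j := by
        simp only [hL']
        split_ifs with hj
        · linarith [hmin j hj]
        · exact le_rfl
      have hcard : (B.filter (0 < L' ·)).card < n := by
        rw [← h]
        refine Finset.card_lt_card ((Finset.ssubset_iff_of_subset ?_).2 ⟨j₀, hj₀, ?_⟩)
        · intro j hj
          by_contra hjK
          have := (Finset.mem_filter.1 hj).2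
          simp [hL', hjK] at this
        · simp only [Finset.mem_filter, hL', hj₀, if_true, m, sub_self, lt_self_iff_false,
            and_false, not_false_iff]
      have hrec := ih _ hcard L' (fun j _ => hL'0 j) f' (by
        intro a ha j hj
        simp only [hf']
        split_ifs with hS
        · simp only [hL', hS hj, if_true]
          linarith [hf a ha j hj]
        · exact hL'0 j) rfl
      have h1 : ∑ a ∈ A, f a ≤ ∑ a ∈ A, f' a + m * (A.filter (S · ⊆ K)).card := by
        rw [Finset.card_filter, Nat.cast_sum, Finset.mul_sum, ← Finset.sum_add_distrib]
        refine Finset.sum_le_sum fun a ha => ?_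
        simp only [hf']
        split_ifs with hS
        · simp
        · simpa using hf0 a ha hS
      have h2 : ∑ j ∈ B, L j = ∑ j ∈ B, L' j + m * K.card := by
        have hc : K.card = ∑ j ∈ B, if j ∈ K then 1 else 0 := by
          rw [← Finset.card_filter, Finset.filter_mem_eq_inter, Finset.inter_eq_right.2 hKB]
        rw [hc, Nat.cast_sum, Finset.mul_sum, ← Finset.sum_add_distrib]
        refine Finset.sum_congr rfl fun j hj => ?_
        simp only [hL']
        split_ifs with hjK
        · simp
        · simp [hL0 j hj hjK]
      have h3 := mul_le_mul_of_nonneg_left (hρ K hKB) hm.le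
      rw [h2]
      linarith

/-- Jordan's inequality gives `sin (π s) ≥ 2 min (s, 1 - s)`, and both `s` and `1 - s` are at least
`d s`. -/
lemma two_mul_mul_le_sin_pi_mul {s d : ℝ} (hs : 0 ≤ s) (hd : 0 ≤ d) (hsd : s ≤ 1 - d) :
    2 * d * s ≤ Real.sin (Real.pi * s) := by
  have hπ := Real.pi_pos
  have key {u : ℝ} (hu : 0 ≤ u) (hu' : u ≤ 1 / 2) : 2 * u ≤ Real.sin (Real.pi * u) := by
    have := Real.mul_le_sin (x := Real.pi * u) (by positivity) (by nlinarith)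
    have e : 2 / Real.pi * (Real.pi * u) = 2 * u := by field_simp
    linarith
  rcases le_total s (1 / 2) with h | h
  · refine le_trans ?_ (key hs h)
    nlinarith
  · have := key (u := 1 - s) (by linarith) (by linarith)
    have e : Real.pi * (1 - s) = Real.pi - Real.pi * s := by ring
    rw [e, Real.sin_pi_sub] at this
    nlinarith

/-! ### Wall coordinates and the pointwise bound. -/

variable {ι M 𝔱 : Type*} [AddCommGroup M] [Module ℝ M] [AddCommGroup 𝔱] [Module ℝ 𝔱]
  {P : RootPairing ι ℝ M 𝔱}

lemma wallCoord_combo (b : P.Base) (θ : ι) (j : Option b.support) {κ : Type*} (s : Finset κ)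
    (w : κ → ℝ) (hw : ∑ k ∈ s, w k = 1) (v : κ → 𝔱) :
    wallCoord b θ j (∑ k ∈ s, w k • v k) = ∑ k ∈ s, w k * wallCoord b θ j (v k) := by
  simp only [wallCoord, map_sum, map_smul, smul_eq_mul, mul_add, Finset.sum_add_distrib,
    ← Finset.sum_mul, hw, one_mul]
  simp only [Finset.sum_div, mul_div_assoc]

lemma sum_mark_mul_wallCoord [P.IsRootSystem] (b : P.Base) (θ : ι) (H : 𝔱) :
    ∑ j, mark b θ j * wallCoord b θ j H = 1 := by
  have h := congrArg (fun x => P.toLinearMap x H) (sum_mark_smul_extRoot b θ)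
  simp only [map_sum, map_smul, LinearMap.sum_apply, LinearMap.smul_apply, smul_eq_mul, map_zero,
    LinearMap.zero_apply] at h
  simp only [wallCoord, mul_add, Finset.sum_add_distrib, ← mul_div_assoc, ← Finset.sum_div, h]
  simp [mark]

lemma toLinearMap_sum_extRoot (b : P.Base) (θ : ι) (n : Option b.support → ℕ) (H : 𝔱) :
    P.toLinearMap (∑ i, n i • extRoot b θ i) H
      = 2 * Real.pi * (∑ i, n i * wallCoord b θ i H - n none) := by
  have hπ := Real.pi_pos
  have h (j : Option b.support) : P.toLinearMap (extRoot b θ j) H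
      = 2 * Real.pi * (wallCoord b θ j H - if j = none then 1 else 0) := by
    simp only [wallCoord]
    field_simp
    ring
  simp only [map_sum, map_nsmul, LinearMap.sum_apply, LinearMap.smul_apply, h, nsmul_eq_mul]
  rw [mul_sub, Finset.mul_sum]
  simp only [mul_sub, Finset.sum_sub_distrib]
  congr 1
  · exact Finset.sum_congr rfl fun j _ => by ring
  · simp [mul_comm]

/-- The affine shift at the node `0` moves the argument of the sine by `n₀ π`, which the absolute
value does not see. -/
lemma norm_exp_rootValue_sub {b : P.Base} {θ : ι} {k : ι} {n : Option b.support → ℕ}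
    (hn : P.root k = ∑ i, n i • extRoot b θ i) (H : 𝔱) :
    ‖Complex.exp (rootValue P k H / 2) - Complex.exp (-(rootValue P k H / 2))‖
      = 2 * |Real.sin (Real.pi * ∑ i, n i * wallCoord b θ i H)| := by
  set s := ∑ i, n i * wallCoord b θ i H
  have h1 : rootValue P k H / 2 = ((Real.pi * s - n none * Real.pi : ℝ) : ℂ) * Complex.I := by
    rw [rootValue, hn, toLinearMap_sum_extRoot]
    change _ * ((2 * Real.pi * (s - n none) : ℝ) : ℂ) / 2 = _
    push_cast
    ring
  have h2 : Complex.exp (rootValue P k H / 2) - Complex.exp (-(rootValue P k H / 2))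
      = 2 * Complex.I * ((Real.sin (Real.pi * s - n none * Real.pi) : ℝ) : ℂ) := by
    rw [h1, ← neg_mul, Complex.exp_mul_I, Complex.exp_mul_I, Complex.cos_neg, Complex.sin_neg,
      Complex.ofReal_sin]
    ring
  rw [h2, norm_mul, Complex.norm_real, Real.norm_eq_abs, Real.sin_sub_nat_mul_pi, abs_mul, abs_pow]
  simp

section

variable [P.IsRootSystem] {b : P.Base} {θ : ι}

/-- At the vertex opposite to wall `i`, `m_i t_i = 1`; at the other vertices it is `0`. As `i ∉ K`,
that vertex has weight `1 / |Kᶜ| ≥ 1 / (r + 1)` in the barycenter of `A_K`. The bound passes to the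
convex hull. -/
lemma mark_mul_wallCoord_baryPiece {I : Finset (Option b.support)} {i : Option b.support}
    (hi : i ∉ I) {H : 𝔱} (hH : H ∈ baryPiece b θ I) :
    (Fintype.card (Option b.support) : ℝ)⁻¹ ≤ mark b θ i * wallCoord b θ i H := by
  classical
  have hsub : baryPiece b θ I ⊆
      {H | (Fintype.card (Option b.support) : ℝ)⁻¹ ≤ mark b θ i * wallCoord b θ i H} := by
    refine convexHull_min ?_ ?_
    · rintro x ⟨K, hK, v, hv, rfl⟩
      have hiK : i ∈ Kᶜ := Finset.mem_compl.2 fun h => hi (hK h)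
      have hw : ∑ k ∈ Kᶜ, Finset.centroidWeights ℝ Kᶜ k = 1 :=
        Finset.sum_centroidWeights_eq_one_of_nonempty ℝ _ ⟨i, hiK⟩
      have hvi (k : Option b.support) (hk : k ≠ i) : wallCoord b θ i (v k) = 0 :=
        (hv k).1 i (Finset.mem_erase.2 ⟨hk.symm, Finset.mem_univ _⟩)
      have hone : mark b θ i * wallCoord b θ i (v i) = 1 := by
        have h := sum_mark_mul_wallCoord b θ (v i)
        rwa [Finset.sum_eq_single i (fun j _ hj => ?_) fun h => absurd (Finset.mem_univ i) h] at h
        rw [(hv i).1 j (Finset.mem_erase.2 ⟨hj, Finset.mem_univ _⟩), mul_zero]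
      have hpos : (0 : ℝ) < (Kᶜ.card : ℝ) := by exact_mod_cast Finset.card_pos.2 ⟨i, hiK⟩
      rw [Set.mem_ofPred_eq, Finset.centroid_def,
        Finset.affineCombination_eq_linear_combination _ _ _ hw, wallCoord_combo b θ i _ _ hw]
      convert_to _ ≤ mark b θ i * ((Kᶜ.card : ℝ)⁻¹ * wallCoord b θ i (v i))
      · congr 1
        refine (Finset.sum_eq_single i (fun j _ hj => ?_) (fun h => absurd hiK h)).trans ?_
        · rw [hvi j hj, mul_zero]
        · simp
      · rw [mul_left_comm, hone, mul_one]
        exact inv_anti₀ hpos (by exact_mod_cast Finset.card_le_univ _)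
    · intro x hx y hy a c ha hc hac
      simp only [Set.mem_ofPred_eq] at hx hy ⊢
      have : wallCoord b θ i (a • x + c • y) = a * wallCoord b θ i x + c * wallCoord b θ i y := by
        have := wallCoord_combo b θ i Finset.univ ![a, c] (by simpa using hac) ![x, y]
        simpa using this
      rw [this]
      calc (Fintype.card (Option b.support) : ℝ)⁻¹
          = a * (Fintype.card (Option b.support) : ℝ)⁻¹
            + c * (Fintype.card (Option b.support) : ℝ)⁻¹ := by rw [← add_mul, hac, one_mul]
        _ ≤ a * (mark b θ i * wallCoord b θ i x) + c * (mark b θ i * wallCoord b θ i y) := by gcongr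
        _ = _ := by ring
  exact hsub hH

lemma wallCoord_le_one_of_mem_alcove (hθ : IsHighestRoot b θ) {H : 𝔱} (hH : H ∈ alcove b θ)
    (j : Option b.support) : wallCoord b θ j H ≤ 1 := by
  have hm (j) := one_le_mark hθ j
  calc wallCoord b θ j H ≤ mark b θ j * wallCoord b θ j H := by nlinarith [hm j, hH j]
    _ ≤ ∑ j, mark b θ j * wallCoord b θ j H :=
        Finset.single_le_sum (f := fun j => mark b θ j * wallCoord b θ j H)
          (fun j _ => mul_nonneg (by linarith [hm j]) (hH j).le) (Finset.mem_univ j)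
    _ = 1 := sum_mark_mul_wallCoord b θ H

variable [Fintype ι] [P.IsIrreducible]

open Classical in
/-- The pointwise bound for the inverse weight on a piece. -/
lemma exists_norm_inv_weight_le (hθ : IsHighestRoot b θ) {I J : Finset (Option b.support)}
    {i : Option b.support} (hi : ∀ j, j ∈ I ↔ j ≠ i) (hJ : J ⊆ I) {ρ : ℝ}
    (hρ : ρ = (posRoots b).card / b.support.card) :
    ∃ C : ℝ, 0 < C ∧ ∀ N : ℝ, 1 ≤ N → ∀ H ∈ piece b θ N I J,
      ‖1 / weight b θ I J H‖ ≤ C * N ^ (ρ * J.card - (subPosRoots b θ J).card)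
        * ∏ j ∈ I \ J, wallCoord b θ j H ^ (-ρ) := by
  have hiI : i ∉ I := fun h => (hi i).1 h rfl
  set d : ℝ := (Fintype.card (Option b.support) : ℝ)⁻¹ with hd
  have hd0 : 0 < d := inv_pos.2 (by exact_mod_cast Fintype.card_pos)
  set A := subPosRoots b θ I
  set A₀ := subPosRoots b θ J
  have hA₀ : A₀ ⊆ A := by
    intro k hk
    obtain ⟨n, hn, h⟩ := mem_subPosRoots.1 hk
    exact mem_subPosRoots.2 ⟨n, fun j hj => hn j fun hj' => hj (hJ hj'), h⟩
  have hex (k : ι) : ∃ n : Option b.support → ℕ, k ∈ A →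
      (∀ j ∉ I, n j = 0) ∧ P.root k = ∑ i, n i • extRoot b θ i := by
    by_cases hk : k ∈ A
    · obtain ⟨n, hn⟩ := mem_subPosRoots.1 hk
      exact ⟨n, fun _ => hn⟩
    · exact ⟨0, fun h => absurd h hk⟩
  choose n hn using hex
  set S : ι → Finset (Option b.support) := fun k => Finset.univ.filter (n k · ≠ 0) with hS
  have hSI : ∀ k ∈ A, S k ⊆ I := by
    intro k hk j hj
    by_contra hjI
    exact (Finset.mem_filter.1 hj).2 ((hn k hk).1 j hjI)
  have hSK (K : Finset (Option b.support)) (k : ι) (hk : k ∈ A) (h : S k ⊆ K) :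
      k ∈ subPosRoots b θ K := by
    refine mem_subPosRoots.2 ⟨n k, fun j hj => ?_, (hn k hk).2⟩
    by_contra h0
    exact hj (h (Finset.mem_filter.2 ⟨Finset.mem_univ _, h0⟩))
  have hSJ (k : ι) (hk : k ∈ A₀) : S k ⊆ J := by
    obtain ⟨n', hn', h'⟩ := mem_subPosRoots.1 hk
    have : n k = n' := eq_of_sum_extRoot_eq hθ ((hn k (hA₀ hk)).2.symm.trans h') (i := i) (by
      rw [(hn k (hA₀ hk)).1 i hiI, hn' i fun h => hiI (hJ h)])
    intro j hj
    by_contra hjJ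
    exact (Finset.mem_filter.1 hj).2 (this ▸ hn' j hjJ)
  have hr : (0 : ℝ) < b.support.card := by
    have : Nonempty ι := ⟨θ⟩
    exact_mod_cast Finset.card_pos.2 b.support_nonempty
  have hdens (K : Finset (Option b.support)) (hK : K ⊆ I) :
      ((A.filter (S · ⊆ K)).card : ℝ) ≤ ρ * K.card := by
    have h1 : (A.filter (S · ⊆ K)).card ≤ (subPosRoots b θ K).card :=
      Finset.card_le_card fun k hk =>
        hSK K k (Finset.mem_filter.1 hk).1 (Finset.mem_filter.1 hk).2
    have h2 : ((subPosRoots b θ K).card * b.support.card : ℝ) ≤ K.card * (posRoots b).card := by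
      exact_mod_cast card_subPosRoots_mul_le hθ (K := K) (i := i) fun h => hiI (hK h)
    calc ((A.filter (S · ⊆ K)).card : ℝ) ≤ (subPosRoots b θ K).card := by exact_mod_cast h1
      _ ≤ K.card * (posRoots b).card / b.support.card := by rwa [le_div_iff₀ hr]
      _ = ρ * K.card := by rw [hρ]; ring
  -- Each of the factors is `2 |sin (π s)| ≥ 4 d s`.
  refine ⟨((4 * d) ^ (A \ A₀).card)⁻¹, by positivity, fun N hN H hH => ?_⟩
  have hN0 : 0 < N := by linarith
  obtain ⟨⟨hHA, hHJ, hHJ'⟩, hHI⟩ := hH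
  set t := fun j => wallCoord b θ j H with ht
  have ht0 (j) : 0 < t j := hHA j
  have ht1 (j) : t j ≤ 1 := wallCoord_le_one_of_mem_alcove hθ hHA j
  set s : ι → ℝ := fun k => ∑ i, n k i * t i with hs
  have hst (k : ι) (j : Option b.support) (hj : j ∈ S k) : t j ≤ s k := by
    have h1 : (1 : ℝ) ≤ n k j := by
      exact_mod_cast Nat.one_le_iff_ne_zero.2 (Finset.mem_filter.1 hj).2
    calc t j ≤ n k j * t j := by nlinarith [ht0 j]
      _ ≤ s k := Finset.single_le_sum (f := fun i => n k i * t i)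
          (fun i _ => mul_nonneg (Nat.cast_nonneg _) (ht0 i).le) (Finset.mem_univ j)
  have hs1 (k : ι) (hk : k ∈ A) : s k ≤ 1 - d := by
    have h1 : s k ≤ ∑ j, mark b θ j * t j - mark b θ i * t i := by
      rw [hs, ← Finset.sum_erase_eq_sub (Finset.mem_univ i)]
      simp only
      rw [← Finset.sum_erase (a := i) Finset.univ (by simp [(hn k hk).1 i hiI])]
      refine Finset.sum_le_sum fun j _ => ?_
      exact mul_le_mul_of_nonneg_right
        (coeff_le_mark hθ (hn k hk).2 ((hn k hk).1 i hiI) j) (ht0 j).le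
    have h2 := mark_mul_wallCoord_baryPiece hiI hHI
    rw [sum_mark_mul_wallCoord] at h1
    linarith
  have hsJ (k : ι) (hk : k ∈ A \ A₀) : N⁻¹ < s k := by
    obtain ⟨hkA, hkA₀⟩ := Finset.mem_sdiff.1 hk
    obtain ⟨j, hj, hjJ⟩ := Finset.not_subset.1 fun h => hkA₀ (hSK J k hkA h)
    exact (hHJ' j hjJ).trans_le (hst k j hj)
  have hNi : 0 < N⁻¹ := inv_pos.2 hN0
  have hs0 (k : ι) (hk : k ∈ A \ A₀) : 0 < s k := hNi.trans (hsJ k hk)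
  have hw : (4 * d) ^ (A \ A₀).card * ∏ k ∈ A \ A₀, s k ≤ ‖weight b θ I J H‖ := by
    rw [weight, norm_prod, ← Finset.prod_const, ← Finset.prod_mul_distrib]
    refine Finset.prod_le_prod (fun k hk => mul_nonneg (by positivity) (hs0 k hk).le)
      fun k hk => ?_
    have hkA := (Finset.mem_sdiff.1 hk).1
    rw [norm_exp_rootValue_sub (hn k hkA).2]
    have := two_mul_mul_le_sin_pi_mul (hs0 k hk).le hd0.le (hs1 k hkA)
    have := this.trans (le_abs_self _)
    linarith
  have hprod : N ^ ((A₀.card : ℝ) - ρ * J.card) * ∏ j ∈ I \ J, t j ^ ρ ≤ ∏ k ∈ A \ A₀, s k := by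
    have hlogN : 0 ≤ Real.log N := Real.log_nonneg hN
    -- Nodes of `J` and roots of `Σ_J⁺` get the cutoff value `log N`. Any other root has a support
    -- node outside `J`, so `s > N⁻¹` and `-log s` stays below the cutoff too. The artificial `log
    -- N` terms for `Σ_J⁺` produce the gain `N ^ (-|Σ_J⁺|)`.
    have hcomb := sum_le_mul_sum_of_card_filter_subset_le A I S hSI ρ hdens
      (fun j => if j ∈ J then Real.log N else -Real.log (t j))
      (fun j _ => by
        split_ifs
        · exact hlogN
        · exact neg_nonneg.2 (Real.log_nonpos (ht0 j).le (ht1 j)))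
      (fun k => if k ∈ A₀ then Real.log N else -Real.log (s k)) (by
        intro k hk j hj
        by_cases hk0 : k ∈ A₀
        · simp [hk0, hSJ k hk0 hj]
        · have hk' : k ∈ A \ A₀ := Finset.mem_sdiff.2 ⟨hk, hk0⟩
          by_cases hjJ : j ∈ J
          · simp only [hk0, hjJ, if_true, if_false]
            rw [← Real.log_inv]
            refine Real.log_le_log (inv_pos.2 (hs0 k hk')) ?_
            exact inv_le_of_inv_le₀ hN0 (hsJ k hk').le
          · simp only [hk0, hjJ, if_false]
            exact neg_le_neg (Real.log_le_log (ht0 j) (hst k j hj)))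
    have e1 : ∑ k ∈ A, (if k ∈ A₀ then Real.log N else -Real.log (s k))
        = A₀.card * Real.log N - ∑ k ∈ A \ A₀, Real.log (s k) := by
      rw [← Finset.sum_sdiff hA₀, add_comm, Finset.sum_congr rfl fun k hk => if_pos hk,
        Finset.sum_congr rfl fun k hk => if_neg (Finset.mem_sdiff.1 hk).2]
      simp [sub_eq_add_neg]
    have e2 : ∑ j ∈ I, (if j ∈ J then Real.log N else -Real.log (t j))
        = J.card * Real.log N - ∑ j ∈ I \ J, Real.log (t j) := by
      rw [← Finset.sum_sdiff hJ, add_comm, Finset.sum_congr rfl fun k hk => if_pos hk,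
        Finset.sum_congr rfl fun k hk => if_neg (Finset.mem_sdiff.1 hk).2]
      simp [sub_eq_add_neg]
    rw [e1, e2] at hcomb
    have hp0 : ∀ j ∈ I \ J, t j ^ ρ ≠ 0 := fun j _ => (Real.rpow_pos_of_pos (ht0 j) _).ne'
    have hpos : 0 < N ^ ((A₀.card : ℝ) - ρ * J.card) * ∏ j ∈ I \ J, t j ^ ρ :=
      mul_pos (Real.rpow_pos_of_pos hN0 _)
        (Finset.prod_pos fun j _ => Real.rpow_pos_of_pos (ht0 j) _)
    rw [← Real.log_le_log_iff hpos (Finset.prod_pos hs0),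
      Real.log_mul (Real.rpow_pos_of_pos hN0 _).ne' (Finset.prod_ne_zero_iff.2 hp0),
      Real.log_rpow hN0, Real.log_prod hp0, Real.log_prod fun k hk => (hs0 k hk).ne',
      Finset.sum_congr rfl fun j _ => Real.log_rpow (ht0 j) ρ, ← Finset.mul_sum]
    linarith
  have hpos : 0 < N ^ ((A₀.card : ℝ) - ρ * J.card) * ∏ j ∈ I \ J, t j ^ ρ :=
    mul_pos (Real.rpow_pos_of_pos hN0 _)
      (Finset.prod_pos fun j _ => Real.rpow_pos_of_pos (ht0 j) _)
  have h4 : 0 < (4 * d) ^ (A \ A₀).card := by positivity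
  rw [norm_div, norm_one, one_div]
  calc ‖weight b θ I J H‖⁻¹
      ≤ ((4 * d) ^ (A \ A₀).card
          * (N ^ ((A₀.card : ℝ) - ρ * J.card) * ∏ j ∈ I \ J, t j ^ ρ))⁻¹ :=
        inv_anti₀ (mul_pos h4 hpos) ((mul_le_mul_of_nonneg_left hprod h4.le).trans hw)
    _ = _ := by
        rw [mul_inv, mul_inv, ← Finset.prod_inv_distrib, ← Real.rpow_neg hN0.le, neg_sub, mul_assoc]
        congr 2
        exact Finset.prod_congr rfl fun j _ => (Real.rpow_neg (ht0 j).le _).symm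

end

end WeylAlcove

/-! ### One-dimensional integrals. -/

namespace WeylAlcove

open MeasureTheory

section Interval

open Classical in
/-- The one-dimensional factors that dominate the inverse weight. -/
noncomputable def profile {β : Type*} (N a : ℝ) (J : Finset β) (j : β) : ℝ → ℝ :=
  if j ∈ J then (Set.Ioc 0 N⁻¹).indicator 1 else (Set.Ioc N⁻¹ 1).indicator (· ^ (-a))

variable {β : Type*} {N a : ℝ} {J : Finset β} {j : β}

lemma profile_nonneg (hN : 1 ≤ N) (x : ℝ) : 0 ≤ profile N a J j x := by
  unfold profile
  split_ifs
  · exact Set.indicator_nonneg (fun _ _ => zero_le_one) x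
  · refine Set.indicator_nonneg (fun x hx => Real.rpow_nonneg ?_ _) x
    exact (inv_nonneg.2 (zero_le_one.trans hN)).trans hx.1.le

lemma intervalIntegrable_rpow_neg (hN : 1 ≤ N) (a : ℝ) :
    IntervalIntegrable (fun x : ℝ => x ^ (-a)) volume N⁻¹ 1 := by
  have hN0 : 0 < N⁻¹ := inv_pos.2 (by linarith)
  refine intervalIntegral.intervalIntegrable_rpow (Or.inr ?_)
  rw [Set.uIcc_of_le (inv_le_one_of_one_le₀ hN)]
  exact fun h => absurd h.1 (not_le.2 hN0)

lemma integrable_profile (hN : 1 ≤ N) : Integrable (profile N a J j) := by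
  unfold profile
  split_ifs
  · exact (integrable_indicator_iff measurableSet_Ioc).2
      (integrableOn_const (by simp) (by simp))
  · rw [integrable_indicator_iff measurableSet_Ioc,
      ← intervalIntegrable_iff_integrableOn_Ioc_of_le (inv_le_one_of_one_le₀ hN)]
    exact intervalIntegrable_rpow_neg hN a

lemma integral_profile_of_mem (hN : 1 ≤ N) (hj : j ∈ J) : ∫ x, profile N a J j x = N⁻¹ := by
  have hN0 : 0 ≤ N⁻¹ := inv_nonneg.2 (by linarith)
  rw [profile, if_pos hj, integral_indicator measurableSet_Ioc]
  simp [hN0]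

lemma integral_profile_of_notMem (hN : 1 ≤ N) (hj : j ∉ J) :
    ∫ x, profile N a J j x = ∫ x in N⁻¹..1, x ^ (-a) := by
  rw [profile, if_neg hj, integral_indicator measurableSet_Ioc,
    intervalIntegral.integral_of_le (inv_le_one_of_one_le₀ hN)]

/-- Raising the exponent to `1 + g` with `g > 0` avoids the logarithm at `a = 1`, so both the
supercritical case (`g = a - 1`) and the critical case (small `g`) are covered. -/
lemma integral_rpow_neg_le_of_le (hN : 1 ≤ N) {g : ℝ} (hg : 0 < g) (hag : a - 1 ≤ g) :
    ∫ x in N⁻¹..1, x ^ (-a) ≤ g⁻¹ * N ^ g := by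
  have hN0 : 0 < N := by linarith
  have hNi : 0 < N⁻¹ := inv_pos.2 hN0
  have hN1 := inv_le_one_of_one_le₀ hN
  calc ∫ x in N⁻¹..1, x ^ (-a) ≤ ∫ x in N⁻¹..1, x ^ (-(1 + g)) := by
        refine intervalIntegral.integral_mono_on hN1 (intervalIntegrable_rpow_neg hN a)
          (intervalIntegrable_rpow_neg hN _) fun x hx => ?_
        exact Real.rpow_le_rpow_of_exponent_ge (hNi.trans_le hx.1) hx.2 (by linarith)
    _ = g⁻¹ * (N ^ g - 1) := by
        rw [integral_rpow (Or.inr ⟨by linarith, ?_⟩)]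
        · have e : -(1 + g) + 1 = -g := by ring
          rw [e, Real.one_rpow, Real.inv_rpow hN0.le, Real.rpow_neg hN0.le, inv_inv]
          field_simp
          ring
        · rw [Set.uIcc_of_le hN1]
          exact fun h => absurd h.1 (not_le.2 hNi)
    _ ≤ g⁻¹ * N ^ g := by
        have : 0 < g⁻¹ := inv_pos.2 hg
        nlinarith

lemma integral_rpow_neg_le_of_lt_one (hN : 1 ≤ N) (ha : a < 1) :
    ∫ x in N⁻¹..1, x ^ (-a) ≤ (1 - a)⁻¹ := by
  have hN0 : 0 < N := by linarith
  rw [integral_rpow (Or.inl (by linarith)), Real.one_rpow, neg_add_eq_sub, ← one_div (1 - a)]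
  have h1 : 0 < 1 - a := by linarith
  have : 0 ≤ N⁻¹ ^ (1 - a) := Real.rpow_nonneg (inv_nonneg.2 hN0.le) _
  exact div_le_div_of_nonneg_right (by linarith) h1.le

end Interval

/-! ### Change of variables to the wall coordinates. -/

variable {ι M 𝔱 : Type*} [AddCommGroup M] [Module ℝ M]

section

variable [AddCommGroup 𝔱] [Module ℝ 𝔱] {P : RootPairing ι ℝ M 𝔱}

/-- The linear part of the wall coordinates. -/
noncomputable def wallLinear (b : P.Base) (θ : ι) (I : Finset (Option b.support)) :
    𝔱 →ₗ[ℝ] (I → ℝ) :=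
  LinearMap.pi fun j => (2 * Real.pi)⁻¹ • P.toLinearMap (extRoot b θ j)

lemma wallCoord_eq_wallLinear_add (b : P.Base) (θ : ι) (I : Finset (Option b.support)) (H : 𝔱) :
    (fun j : I => wallCoord b θ j H)
      = wallLinear b θ I H + fun j : I => if (j : Option b.support) = none then 1 else 0 := by
  ext j
  simp [wallLinear, wallCoord, div_eq_inv_mul]

variable [P.IsRootSystem] {b : P.Base} {θ : ι}

/-- The mark relation recovers the missing root from the others, so a vector in the kernel is killed
by all simple roots. -/
lemma wallLinear_injective (hθ : IsHighestRoot b θ) {I : Finset (Option b.support)}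
    {i : Option b.support} (hi : ∀ j, j ∈ I ↔ j ≠ i) :
    Function.Injective (wallLinear b θ I) := by
  rw [injective_iff_map_eq_zero]
  intro H hH
  have hπ := Real.pi_pos
  have h1 (j : Option b.support) (hj : j ≠ i) : P.toLinearMap (extRoot b θ j) H = 0 := by
    have := congrFun hH ⟨j, (hi j).2 hj⟩
    simpa [wallLinear, hπ.ne'] using this
  have h2 : P.toLinearMap (extRoot b θ i) H = 0 := by
    have h := congrArg (fun x => P.toLinearMap x H) (sum_mark_smul_extRoot b θ)
    simp only [map_sum, map_smul, LinearMap.sum_apply, LinearMap.smul_apply, smul_eq_mul, map_zero,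
      LinearMap.zero_apply] at h
    rw [Finset.sum_eq_single i (fun j _ hj => by rw [h1 j hj, mul_zero])
      (fun h => absurd (Finset.mem_univ i) h)] at h
    exact (mul_eq_zero.1 h).resolve_left (by linarith [one_le_mark hθ i])
  have h3 (j : Option b.support) : P.toLinearMap (extRoot b θ j) H = 0 := by
    by_cases hj : j = i
    · rw [hj, h2]
    · exact h1 j hj
  have h4 : P.toLinearMap.flip H = 0 := by
    refine b.toWeightBasis.ext fun j => ?_
    simpa [extRoot] using h3 (some j)
  exact P.flip.toPerfPair.injective (by simpa using h4)

lemma finrank_eq_card_support' (b : P.Base) : Module.finrank ℝ 𝔱 = b.support.card := by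
  rw [Module.finrank_eq_card_basis b.toCoweightBasis]; simp

end

variable [NormedAddCommGroup 𝔱] [NormedSpace ℝ 𝔱] [FiniteDimensional ℝ 𝔱]
  {P : RootPairing ι ℝ M 𝔱}

lemma continuous_wallCoord (b : P.Base) (θ : ι) (j : Option b.support) :
    Continuous (wallCoord b θ j) := by
  have : Continuous (P.toLinearMap (extRoot b θ j)) :=
    LinearMap.continuous_of_finiteDimensional _
  unfold wallCoord
  fun_prop

lemma continuous_weight [Fintype ι] (b : P.Base) (θ : ι) (I J : Finset (Option b.support)) :
    Continuous (weight b θ I J) := by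
  have (k : ι) : Continuous (P.toLinearMap (P.root k)) :=
    LinearMap.continuous_of_finiteDimensional _
  unfold weight rootValue
  fun_prop

variable [MeasurableSpace 𝔱] [BorelSpace 𝔱]

/-- In the wall coordinates, a Haar measure is a multiple of the Lebesgue measure. -/
lemma exists_lintegral_wallCoord_eq [P.IsRootSystem] {b : P.Base} {θ : ι}
    (hθ : IsHighestRoot b θ) {I : Finset (Option b.support)} {i : Option b.support}
    (hi : ∀ j, j ∈ I ↔ j ≠ i) (hI : I.card = b.support.card)
    (μ : Measure 𝔱) [μ.IsAddHaarMeasure] :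
    ∃ c : ℝ, 0 < c ∧ ∀ g : (I → ℝ) → ℝ≥0∞, Measurable g →
      ∫⁻ H, g (fun j : I => wallCoord b θ j H) ∂μ = ENNReal.ofReal c * ∫⁻ y, g y := by
  have hfin : Module.finrank ℝ 𝔱 = Module.finrank ℝ (I → ℝ) := by
    rw [finrank_eq_card_support' b]; simp [hI]
  let e := (LinearEquiv.ofInjectiveOfFinrankEq (wallLinear b θ I) (wallLinear_injective hθ hi)
    hfin).toContinuousLinearEquiv
  have he (H : 𝔱) : e H = wallLinear b θ I H := rfl
  have hm : Measure.IsAddHaarMeasure (μ.map e) := e.isAddHaarMeasure_map μ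
  refine ⟨Measure.addHaarScalarFactor (μ.map e) volume, ?_, fun g hg => ?_⟩
  · exact_mod_cast Measure.addHaarScalarFactor_pos_of_isAddHaarMeasure _ _
  · set v : I → ℝ := fun j => if (j : Option b.support) = none then 1 else 0
    have hg' : Measurable fun y => g (y + v) := hg.comp (measurable_id.add_const v)
    calc ∫⁻ H, g (fun j : I => wallCoord b θ j H) ∂μ
        = ∫⁻ H, g (e H + v) ∂μ := by simp only [wallCoord_eq_wallLinear_add, he, v]
      _ = ∫⁻ y, g (y + v) ∂(μ.map e) :=
          (lintegral_map hg' e.continuous.measurable).symm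
      _ = ∫⁻ y, g (y + v)
            ∂(Measure.addHaarScalarFactor (μ.map e) volume • (volume : Measure (I → ℝ))) := by
          rw [← Measure.isAddLeftInvariant_eq_smul (μ.map e) volume]
      _ = _ := by
          rw [lintegral_smul_measure, lintegral_add_right_eq_self]
          simp [ENNReal.smul_def]

/-! ### Integration of the pointwise bound. -/

variable [Fintype ι] [P.IsRootSystem] [P.IsIrreducible] {b : P.Base} {θ : ι}

/-- After the change of variables the integral factors: each node of `J` gives `N⁻¹`, each of the `r
- |J|` others at most `K N ^ g`. The `p`-th root of this product and the pointwise prefactor give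
the exponent in `hE`. -/
lemma exists_invWeightNorm_le_of_ne_top (hθ : IsHighestRoot b θ)
    {I J : Finset (Option b.support)} {i : Option b.support} (hi : ∀ j, j ∈ I ↔ j ≠ i)
    (hI : I.card = b.support.card) (hJ : J ⊆ I) (μ : Measure 𝔱) [μ.IsAddHaarMeasure]
    {p : ℝ≥0∞} (hp : 0 < p) (hp' : p ≠ ⊤) {ρ : ℝ}
    (hρ : ρ = (posRoots b).card / b.support.card) {K g : ℝ} (hK : 0 < K)
    (hg : ∀ N : ℝ, 1 ≤ N → ∫ x in N⁻¹..1, x ^ (-(ρ * p.toReal)) ≤ K * N ^ g) {E : ℝ}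
    (hE : ρ * J.card - (subPosRoots b θ J).card
      + (g * (b.support.card - J.card) - J.card) / p.toReal ≤ E) :
    ∃ C : ℝ, 0 < C ∧ ∀ N : ℝ, 1 ≤ N →
      invWeightNorm b θ μ p N I J ≤ ENNReal.ofReal (C * N ^ E) := by
  classical
  obtain ⟨C, hC, hbound⟩ := exists_norm_inv_weight_le hθ hi hJ hρ
  obtain ⟨c, hc, hchange⟩ := exists_lintegral_wallCoord_eq hθ hi hI μ
  set q := p.toReal with hq
  have hq0 : 0 < q := ENNReal.toReal_pos hp.ne' hp'
  set e : ℝ := ρ * J.card - (subPosRoots b θ J).card with he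
  set m := (I \ J).card with hm
  have hmr : (m : ℝ) = b.support.card - J.card := by
    rw [hm, Finset.card_sdiff_of_subset hJ, Nat.cast_sub (Finset.card_le_card hJ), hI]
  refine ⟨C * (c * K ^ m) ^ q⁻¹, by positivity, fun N hN => ?_⟩
  have hN0 : 0 < N := by linarith
  set D : ℝ := (C * N ^ e) ^ q with hD
  have hD0 : 0 ≤ D := by positivity
  have hprofI : Integrable fun y : I → ℝ =>
      D * ∏ j : I, profile N (ρ * q) J (j : Option b.support) (y j) :=
    (Integrable.fintype_prod (f := fun (j : I) => profile N (ρ * q) J (j : Option b.support))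
      fun j => integrable_profile hN).const_mul D
  have hmeas : Measurable fun y : I → ℝ =>
      ENNReal.ofReal (D * ∏ j : I, profile N (ρ * q) J (j : Option b.support) (y j)) := by
    refine ENNReal.measurable_ofReal.comp (measurable_const.mul ?_)
    refine Finset.measurable_prod _ fun j _ => Measurable.comp ?_ (measurable_pi_apply j)
    split_ifs
    · exact measurable_one.indicator measurableSet_Ioc
    · exact (measurable_id.pow_const _).indicator measurableSet_Ioc
  have hcoord : Measurable fun H : 𝔱 => fun j : I => wallCoord b θ j H :=
    measurable_pi_lambda _ fun j => (continuous_wallCoord b θ j).measurable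
  have hpt : ∀ H ∈ piece b θ N I J, ‖1 / weight b θ I J H‖ₑ ^ q ≤
      ENNReal.ofReal (D * ∏ j : I, profile N (ρ * q) J (j : Option b.support)
        (wallCoord b θ j H)) := by
    intro H hH
    have hb := hbound N hN H hH
    obtain ⟨⟨hHA, hHJ, hHJ'⟩, -⟩ := hH
    rw [← ofReal_norm, ENNReal.ofReal_rpow_of_nonneg (norm_nonneg _) hq0.le]
    refine ENNReal.ofReal_le_ofReal ?_
    have h1 : ∏ j : I, profile N (ρ * q) J (j : Option b.support) (wallCoord b θ j H)
        = ∏ j ∈ I \ J, wallCoord b θ j H ^ (-(ρ * q)) := by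
      rw [Finset.prod_coe_sort I fun j => profile N (ρ * q) J j (wallCoord b θ j H),
        ← Finset.prod_sdiff hJ, Finset.prod_eq_one (s := J), mul_one]
      · refine Finset.prod_congr rfl fun j hj => ?_
        have hjJ := (Finset.mem_sdiff.1 hj).2
        rw [profile, if_neg hjJ, Set.indicator_of_mem]
        exact ⟨hHJ' j hjJ, wallCoord_le_one_of_mem_alcove hθ hHA j⟩
      · intro j hj
        rw [profile, if_pos hj, Set.indicator_of_mem, Pi.one_apply]
        exact ⟨hHA j, hHJ j hj⟩
    have h2 : D * ∏ j ∈ I \ J, wallCoord b θ j H ^ (-(ρ * q))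
        = (C * N ^ e * ∏ j ∈ I \ J, wallCoord b θ j H ^ (-ρ)) ^ q := by
      rw [Real.mul_rpow (by positivity)
        (Finset.prod_nonneg fun j _ => Real.rpow_nonneg (hHA j).le _),
        ← Real.finsetProd_rpow _ _ fun j _ => Real.rpow_nonneg (hHA j).le _]
      congr 1
      refine Finset.prod_congr rfl fun j _ => ?_
      rw [← Real.rpow_mul (hHA j).le, neg_mul]
    rw [h1, h2]
    exact Real.rpow_le_rpow (norm_nonneg _) hb hq0.le
  have hprod : ∏ j : I, ∫ x, profile N (ρ * q) J (j : Option b.support) x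
      ≤ N⁻¹ ^ J.card * (K * N ^ g) ^ m := by
    rw [Finset.prod_coe_sort I fun j => ∫ x, profile N (ρ * q) J j x,
      ← Finset.prod_sdiff hJ, mul_comm]
    refine mul_le_mul (le_of_eq ?_) ?_ (Finset.prod_nonneg fun j _ =>
      integral_nonneg fun x => profile_nonneg hN x) (by positivity)
    · exact Finset.prod_eq_pow_card fun j hj => integral_profile_of_mem hN hj
    · rw [hm, ← Finset.prod_const]
      refine Finset.prod_le_prod (fun j _ => integral_nonneg fun x => profile_nonneg hN x)
        fun j hj => ?_
      rw [integral_profile_of_notMem hN (Finset.mem_sdiff.1 hj).2]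
      exact hg N hN
  have hlint : ∫⁻ H in piece b θ N I J, ‖1 / weight b θ I J H‖ₑ ^ q ∂μ
      ≤ ENNReal.ofReal (c * (D * (N⁻¹ ^ J.card * (K * N ^ g) ^ m))) := by
    calc ∫⁻ H in piece b θ N I J, ‖1 / weight b θ I J H‖ₑ ^ q ∂μ
        ≤ ∫⁻ H in piece b θ N I J, ENNReal.ofReal (D * ∏ j : I,
            profile N (ρ * q) J (j : Option b.support) (wallCoord b θ j H)) ∂μ :=
          setLIntegral_mono (hmeas.comp hcoord) hpt
      _ ≤ ∫⁻ H, ENNReal.ofReal (D * ∏ j : I,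
            profile N (ρ * q) J (j : Option b.support) (wallCoord b θ j H)) ∂μ :=
          setLIntegral_le_lintegral _ _
      _ = ENNReal.ofReal c * ENNReal.ofReal (D * ∏ j : I,
            ∫ x, profile N (ρ * q) J (j : Option b.support) x) := by
          rw [hchange _ hmeas, ← ofReal_integral_eq_lintegral_ofReal hprofI
            (Filter.Eventually.of_forall fun y => mul_nonneg hD0
              (Finset.prod_nonneg fun j _ => profile_nonneg hN _)),
            integral_const_mul, integral_fintype_prod_volume_eq_prod
              (fun (j : I) => profile N (ρ * q) J (j : Option b.support))]
      _ ≤ _ := by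
          rw [← ENNReal.ofReal_mul hc.le]
          exact ENNReal.ofReal_le_ofReal
            (mul_le_mul_of_nonneg_left (mul_le_mul_of_nonneg_left hprod hD0) hc.le)
  rw [invWeightNorm, eLpNorm_eq_lintegral_rpow_enorm_toReal hp.ne' hp', one_div]
  calc (∫⁻ H in piece b θ N I J, ‖1 / weight b θ I J H‖ₑ ^ q ∂μ) ^ q⁻¹
      ≤ (ENNReal.ofReal (c * (D * (N⁻¹ ^ J.card * (K * N ^ g) ^ m)))) ^ q⁻¹ :=
        ENNReal.rpow_le_rpow hlint (inv_nonneg.2 hq0.le)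
    _ = ENNReal.ofReal ((c * (D * (N⁻¹ ^ J.card * (K * N ^ g) ^ m))) ^ q⁻¹) :=
        ENNReal.ofReal_rpow_of_nonneg (by positivity) (inv_nonneg.2 hq0.le)
    _ ≤ _ := by
        refine ENNReal.ofReal_le_ofReal ?_
        have h1 : c * (D * (N⁻¹ ^ J.card * (K * N ^ g) ^ m))
            = D * ((c * K ^ m) * N ^ (g * m - J.card)) := by
          rw [mul_pow, ← Real.rpow_natCast N⁻¹, Real.inv_rpow hN0.le, ← Real.rpow_neg hN0.le,
            ← Real.rpow_natCast (N ^ g), ← Real.rpow_mul hN0.le, sub_eq_neg_add,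
            Real.rpow_add hN0]
          ring
        rw [h1, Real.mul_rpow hD0 (by positivity), Real.mul_rpow (by positivity) (by positivity),
          hD, Real.rpow_rpow_inv (by positivity) hq0.ne', ← Real.rpow_mul hN0.le]
        calc C * N ^ e * ((c * K ^ m) ^ q⁻¹ * N ^ ((g * m - J.card) * q⁻¹))
            = C * (c * K ^ m) ^ q⁻¹ * N ^ (e + (g * m - J.card) * q⁻¹) := by
              rw [Real.rpow_add hN0]; ring
          _ ≤ C * (c * K ^ m) ^ q⁻¹ * N ^ E := by
              refine mul_le_mul_of_nonneg_left (Real.rpow_le_rpow_of_exponent_le hN ?_)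
                (by positivity)
              rw [hmr, ← div_eq_mul_inv]
              exact hE

/-- Each `t_j ^ (-ρ)` with `j ∉ J` is at most `N ^ ρ`, and `ρ r = |Σ⁺|`. -/
lemma exists_invWeightNorm_top_le (hθ : IsHighestRoot b θ)
    {I J : Finset (Option b.support)} {i : Option b.support} (hi : ∀ j, j ∈ I ↔ j ≠ i)
    (hI : I.card = b.support.card) (hJ : J ⊆ I) (μ : Measure 𝔱) :
    ∃ C : ℝ, 0 < C ∧ ∀ N : ℝ, 1 ≤ N → invWeightNorm b θ μ ⊤ N I J ≤
      ENNReal.ofReal (C * N ^ ((posRoots b).card - (subPosRoots b θ J).card : ℝ)) := by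
  classical
  set ρ : ℝ := (posRoots b).card / b.support.card with hρ
  obtain ⟨C, hC, hbound⟩ := exists_norm_inv_weight_le hθ hi hJ hρ
  refine ⟨C, hC, fun N hN => ?_⟩
  have hN0 : 0 < N := by linarith
  have hr : (b.support.card : ℝ) ≠ 0 := by
    have : Nonempty ι := ⟨θ⟩
    exact_mod_cast (Finset.card_pos.2 b.support_nonempty).ne'
  have hρ0 : 0 ≤ ρ := by positivity
  rw [invWeightNorm, eLpNorm_exponent_top]
  refine eLpNormEssSup_le_of_ae_bound ?_
  have hmeas : Measurable (weight b θ I J) := (continuous_weight b θ I J).measurable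
  rw [ae_restrict_iff (measurableSet_le (by fun_prop) measurable_const)]
  refine Filter.Eventually.of_forall fun H hH => (hbound N hN H hH).trans ?_
  obtain ⟨⟨hHA, hHJ, hHJ'⟩, -⟩ := hH
  have h1 : ∏ j ∈ I \ J, wallCoord b θ j H ^ (-ρ) ≤ (N ^ ρ) ^ (I \ J).card := by
    rw [← Finset.prod_const]
    refine Finset.prod_le_prod (fun j _ => Real.rpow_nonneg (hHA j).le _) fun j hj => ?_
    rw [Real.rpow_neg (hHA j).le, ← Real.inv_rpow (hHA j).le]
    refine Real.rpow_le_rpow (inv_nonneg.2 (hHA j).le) ?_ hρ0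
    exact inv_le_of_inv_le₀ hN0 (hHJ' j (Finset.mem_sdiff.1 hj).2).le
  calc _ ≤ C * N ^ (ρ * J.card - (subPosRoots b θ J).card) * (N ^ ρ) ^ (I \ J).card := by gcongr
    _ = _ := by
      rw [← Real.rpow_natCast (N ^ ρ), ← Real.rpow_mul hN0.le, mul_assoc, ← Real.rpow_add hN0,
        Finset.card_sdiff_of_subset hJ, Nat.cast_sub (Finset.card_le_card hJ), hI]
      congr 2
      rw [hρ]
      field_simp
      ring

end WeylAlcove

/-! ### The three regimes, according to the sign of `ρ p - 1`. -/

theorem mainTheorem6 {ι M 𝔱 : Type*} [Fintype ι] [AddCommGroup M] [Module ℝ M]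
    [NormedAddCommGroup 𝔱] [NormedSpace ℝ 𝔱] [FiniteDimensional ℝ 𝔱]
    [MeasurableSpace 𝔱] [BorelSpace 𝔱]
    (μ : MeasureTheory.Measure 𝔱) [μ.IsAddHaarMeasure]
    (P : RootPairing ι ℝ M 𝔱) [P.IsRootSystem] [P.IsCrystallographic] [P.IsReduced]
    [P.IsIrreducible]
    (b : P.Base) (θ : ι) (hθ : WeylAlcove.IsHighestRoot b θ)
    (I J : Finset (Option b.support)) (hI : I.card = b.support.card) (hJ : J ⊆ I)
    (p : ℝ≥0∞) (hp : 0 < p) :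
    ((b.support.card : ℝ≥0∞) / ((WeylAlcove.posRoots b).card : ℝ≥0∞) < p →
      ∃ C : ℝ, 0 < C ∧ ∀ N : ℝ, 1 ≤ N →
        WeylAlcove.invWeightNorm b θ μ p N I J ≤
          ENNReal.ofReal (C * N ^ (((WeylAlcove.posRoots b).card : ℝ)
            - ((WeylAlcove.subPosRoots b θ J).card : ℝ)
            - ((b.support.card : ℝ≥0∞) / p).toReal))) ∧
    (p = (b.support.card : ℝ≥0∞) / ((WeylAlcove.posRoots b).card : ℝ≥0∞) →
      ∀ ε : ℝ, 0 < ε → ∃ C : ℝ, 0 < C ∧ ∀ N : ℝ, 1 ≤ N →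
        WeylAlcove.invWeightNorm b θ μ p N I J ≤
          ENNReal.ofReal (C * N ^ (-((WeylAlcove.subPosRoots b θ J).card : ℝ) + ε))) ∧
    (p < (b.support.card : ℝ≥0∞) / ((WeylAlcove.posRoots b).card : ℝ≥0∞) →
      ∃ C : ℝ, 0 < C ∧ ∀ N : ℝ, 1 ≤ N →
        WeylAlcove.invWeightNorm b θ μ p N I J ≤
          ENNReal.ofReal (C * N ^ (-((WeylAlcove.subPosRoots b θ J).card : ℝ)))) := by
  classical
  have : Nonempty ι := ⟨θ⟩
  obtain ⟨i, hi⟩ : ∃ i : Option b.support, ∀ j, j ∈ I ↔ j ≠ i := by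
    have h1 : Iᶜ.card = 1 := by
      rw [Finset.card_compl, hI]; simp
    obtain ⟨i, h⟩ := Finset.card_eq_one.1 h1
    refine ⟨i, fun j => ?_⟩
    have := Finset.ext_iff.1 h j
    simp only [Finset.mem_compl, Finset.mem_singleton] at this
    tauto
  set r := b.support.card with hr
  set s := (WeylAlcove.posRoots b).card with hs
  have hr0 : 0 < r := Finset.card_pos.2 b.support_nonempty
  have hs0 : 0 < s := WeylAlcove.card_posRoots_pos b
  have hr0' : (0 : ℝ) < r := by exact_mod_cast hr0
  have hs0' : (0 : ℝ) < s := by exact_mod_cast hs0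
  have hcrit : (r : ℝ≥0∞) / (s : ℝ≥0∞) ≠ ⊤ :=
    ENNReal.div_ne_top (by simp) (by exact_mod_cast hs0.ne')
  have hcrit' : ((r : ℝ≥0∞) / (s : ℝ≥0∞)).toReal = r / s := by simp [ENNReal.toReal_div]
  have hJr : (J.card : ℝ) ≤ r := by exact_mod_cast hI ▸ Finset.card_le_card hJ
  have hJ0 : (0 : ℝ) ≤ J.card := Nat.cast_nonneg _
  refine ⟨fun h => ?_, fun h ε hε => ?_, fun h => ?_⟩
  · rcases eq_or_ne p ⊤ with rfl | hp'
    · simpa using WeylAlcove.exists_invWeightNorm_top_le hθ hi hI hJ μ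
    have hq0 : 0 < p.toReal := ENNReal.toReal_pos hp.ne' hp'
    have hq : 0 < (s : ℝ) / r * p.toReal - 1 := by
      have := (ENNReal.toReal_lt_toReal hcrit hp').2 h
      rw [hcrit', div_lt_iff₀ hs0'] at this
      rw [sub_pos, div_mul_eq_mul_div, lt_div_iff₀ hr0']
      linarith
    refine WeylAlcove.exists_invWeightNorm_le_of_ne_top hθ hi hI hJ μ hp hp' rfl
      (inv_pos.2 hq) (fun N hN => WeylAlcove.integral_rpow_neg_le_of_le hN hq le_rfl) (le_of_eq ?_)
    rw [ENNReal.toReal_div, ENNReal.toReal_natCast, ← hr, ← hs]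
    field_simp
    ring
  · have hp' : p ≠ ⊤ := h ▸ hcrit
    have hq : p.toReal = r / s := h ▸ hcrit'
    -- Taking the root multiplies `g (r - |J|)` by `1 / p = s / r`, so `g = ε / s` loses at most `ε`
    -- in the exponent.
    have hg : 0 < ε / s := by positivity
    refine WeylAlcove.exists_invWeightNorm_le_of_ne_top hθ hi hI hJ μ hp hp' rfl
      (inv_pos.2 hg) (fun N hN => WeylAlcove.integral_rpow_neg_le_of_le hN hg ?_) ?_
    · rw [hq, ← hr, ← hs, div_mul_div_comm, mul_comm (s : ℝ), div_self (by positivity), sub_self]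
      exact hg.le
    · rw [hq, ← hr, ← hs]
      have e : (s : ℝ) / r * J.card - (WeylAlcove.subPosRoots b θ J).card
          + (ε / s * (r - J.card) - J.card) / (r / s)
          = -((WeylAlcove.subPosRoots b θ J).card : ℝ) + ε - ε * J.card / r := by
        field_simp
        ring
      rw [e]
      have : 0 ≤ ε * J.card / r := by positivity
      linarith
  · have hp' : p ≠ ⊤ := (h.trans_le le_top).ne
    have hq0 : 0 < p.toReal := ENNReal.toReal_pos hp.ne' hp'
    have hq : (s : ℝ) / r * p.toReal < 1 := by
      have := (ENNReal.toReal_lt_toReal hp' hcrit).2 h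
      rw [hcrit', lt_div_iff₀ hs0'] at this
      rw [div_mul_eq_mul_div, div_lt_iff₀ hr0']
      linarith
    refine WeylAlcove.exists_invWeightNorm_le_of_ne_top hθ hi hI hJ μ hp hp' rfl (g := 0)
      (inv_pos.2 (sub_pos.2 hq)) (fun N hN => ?_) ?_
    · rw [Real.rpow_zero, mul_one]
      exact WeylAlcove.integral_rpow_neg_le_of_lt_one hN hq
    · rw [← hr, ← hs]
      -- The nodes of `J` leave an extra factor `N ^ (-|J| (1 / p - ρ))`, at most `1` here and
      -- discarded.
      have e : (s : ℝ) / r * J.card - (WeylAlcove.subPosRoots b θ J).card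
          + (0 * (r - J.card) - J.card) / p.toReal
          = -((WeylAlcove.subPosRoots b θ J).card : ℝ)
            - J.card * ((1 - s / r * p.toReal) / p.toReal) := by
        field_simp
        ring
      rw [e]
      have : 0 ≤ J.card * ((1 - s / r * p.toReal) / p.toReal) :=
        mul_nonneg hJ0 (div_nonneg (sub_nonneg.2 hq.le) hq0.le)
      linarith
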